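/- Fix $c$ with $0<c<1/2$, put $a=\frac{1}{2(1-c)}$, $b=\frac{1}{2c}$, $I=[0,1]$, and let $f_0,f_1:I\to I$ be the piecewise linear homeomorphisms \[ f_0(x)=\begin{cases}ax,&0\le x\le 1-c,\\ 1-b(1-x),&1-c\le x\le 1,\end{cases}\qquad f_1(x)=\begin{cases}bx,&0\le x\le c,\\ 1-a(1-x),&c\le x\le 1.\end{cases} \] Let $\Sigma=\{0,1\}^{\mathbb Z}$ and $\Sigma_+=\{0,1\}^{\{0,1,2,\dots\}}$ carry the $(1/2,1/2)$ Bernoulli measures $\mu$ and $\mu_+$, let $\sigma$ be the left shift on $\Sigma$, let $P:\Sigma\to\Sigma_+$ be the projection forgetting the coordinates with negative index, and let $F:\Sigma\times I\to\Sigma\times I$, $F(\omega,x)=(\sigma\omega,f_{\omega_0}(x))$. Let $\pi_2:\Sigma\times I\to I$ be the projection to the second coordinate and let $\lambda$ be Lebesgue measure on $I$. For $n\ge0$, $m\ge1$ let $\phi_{n,m}(\omega)$ be the unique number with $F^{-n}(\omega,\phi_{n,m}(\omega))=(\sigma^{-n}\omega,\frac1m)$, and let \[ \phi(\omega)=\lim_{m\to\infty}\lim_{N\to\infty}\inf_{n\ge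 N}\phi_{n,m}(\omega). \] For a measurable $\psi:\Sigma\to I$ let $\mu_\psi$ be the graph measure $\mu_\psi(A)=\mu\{\omega:(\omega,\psi(\omega))\in A\}$. Say that $\psi$ separates the basins if for $\mu$-almost every $\omega$ one has $0<\psi(\omega)<1$, $\lim_{n\to\infty}\pi_2(F^{-n}(\omega,x))=0$ for every $x\in I$ with $x<\psi(\omega)$, and $\lim_{n\to\infty}\pi_2(F^{-n}(\omega,x))=1$ for every $x\in I$ with $x>\psi(\omega)$. Then $\phi$ is measurable and separates the basins, and \[ (P\times\mathrm{id}_I)_*(\mu_\phi)=\mu_+\times\lambda . \] Moreover, the same equality holds with $\phi$ replaced by any measurable $\psi:\Sigma\to I$ that separates the basins. -/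

import Mathlib

open MeasureTheory Filter Topology unitInterval

noncomputable section

namespace RandomInterval

/-- The point `1 / (m + 1)` of `[0,1]`. -/
def invSucc (m : ℕ) : I :=
  ⟨1 / ((m : ℝ) + 1), by positivity, by
    rw [div_le_one (by positivity)]; linarith [(Nat.cast_nonneg m : (0 : ℝ) ≤ m)]⟩

/-! ### General skew products over an invertible base -/

section General

variable {Ω : Type*}

/-- For an invertible base map `R` and an invertible skew product `G` over `R`, the
number `φ_{n,m}(ϑ)` given by `G^n (ϑ, φ_{n,m}(ϑ)) = (R^n ϑ, 1/m)`.
The positive integer of the formula is `m + 1` here, so that `m` ranges over `ℕ`. -/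
def phiNM (R : Equiv.Perm Ω) (G : Equiv.Perm (Ω × I)) (n m : ℕ) (ϑ : Ω) : I :=
  ((G ^ n)⁻¹ ((R ^ n) ϑ, invSucc m)).2

/-- The boundary function of the basin of level `0` for `G`,
`φ(ϑ) = lim_{m → ∞} lim_{N → ∞} inf_{n ≥ N} φ_{n,m}(ϑ)`. The inner limit is of a sequence
increasing in `N` (hence a supremum), the outer one of a sequence decreasing in `m` (hence an
infimum); all of them are taken in the complete lattice `[0,1]`. -/
def basinBoundary (R : Equiv.Perm Ω) (G : Equiv.Perm (Ω × I)) (ϑ : Ω) : I :=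
  ⨅ m : ℕ, ⨆ N : ℕ, ⨅ n : ℕ, ⨅ _ : N ≤ n, phiNM R G n m ϑ

theorem basinBoundary_inner_tendsto (R : Equiv.Perm Ω) (G : Equiv.Perm (Ω × I)) (ϑ : Ω)
    (m : ℕ) :
    Tendsto (fun N : ℕ => ⨅ n : ℕ, ⨅ _ : N ≤ n, phiNM R G n m ϑ) atTop
      (𝓝 (⨆ N : ℕ, ⨅ n : ℕ, ⨅ _ : N ≤ n, phiNM R G n m ϑ)) :=
  tendsto_atTop_iSup fun _ _ h =>
    le_iInf₂ fun n hn => iInf₂_le_of_le n (h.trans hn) le_rfl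

/-- The graph measure `μ_ψ(A) = μ {ϑ : (ϑ, ψ(ϑ)) ∈ A}`. -/
def graphMeasure [MeasurableSpace Ω] (μ : Measure Ω) (ψ : Ω → I) : Measure (Ω × I) :=
  μ.map fun ϑ => (ϑ, ψ ϑ)

theorem graphMeasure_apply [MeasurableSpace Ω] (μ : Measure Ω) {ψ : Ω → I}
    (hψ : Measurable ψ) {A : Set (Ω × I)} (hA : MeasurableSet A) :
    graphMeasure μ ψ A = μ {ϑ | (ϑ, ψ ϑ) ∈ A} :=
  Measure.map_apply (measurable_id.prodMk hψ) hA

/-- `ψ : Ω → (0,1)` separates the backward basins of levels `0` and `1` of the invertible skew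
product `F`: for almost every `ϑ`, the second coordinate of `F^{-n}(ϑ, x)` tends to `0` if
`x < ψ(ϑ)`, and to `1` if `x > ψ(ϑ)`. -/
def SeparatesBasins [MeasurableSpace Ω] (μ : Measure Ω) (F : Equiv.Perm (Ω × I))
    (ψ : Ω → I) : Prop :=
  ∀ᵐ ϑ ∂μ, 0 < ψ ϑ ∧ ψ ϑ < 1 ∧
    (∀ x : I, x < ψ ϑ → Tendsto (fun n : ℕ => ((F⁻¹ ^ n) (ϑ, x)).2) atTop (𝓝 0)) ∧
    (∀ x : I, ψ ϑ < x → Tendsto (fun n : ℕ => ((F⁻¹ ^ n) (ϑ, x)).2) atTop (𝓝 1))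

end General

/-! ### The Bernoulli shifts with probabilities `(1/2, 1/2)` -/

/-- The space of two-sided sequences of zeros and ones. -/
abbrev TwoSided : Type := ℤ → Fin 2

/-- The space of one-sided sequences of zeros and ones. -/
abbrev OneSided : Type := ℕ → Fin 2

/-- The `(1/2, 1/2)` measure on the alphabet `{0, 1}`. -/
def coin : Measure (Fin 2) := (PMF.uniformOfFintype (Fin 2)).toMeasure

/-- The Bernoulli measure `μ` on two-sided sequences. -/
def muTwo : Measure TwoSided := Measure.infinitePi fun _ : ℤ => coin

/-- The Bernoulli measure `μ_+` on one-sided sequences. -/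
def muOne : Measure OneSided := Measure.infinitePi fun _ : ℕ => coin

/-- The left shift `(σ ω)_n = ω_{n+1}` on two-sided sequences. -/
def shift : Equiv.Perm TwoSided where
  toFun ω n := ω (n + 1)
  invFun ω n := ω (n - 1)
  left_inv ω := by ext n; simp
  right_inv ω := by ext n; simp

/-- The projection `P` that forgets the coordinates with negative index. -/
def proj (ω : TwoSided) : OneSided := fun n => ω (n : ℤ)

/-! ### The piecewise linear family -/

/-- The slope `a = 1 / (2 (1 - c))`. -/
def slopeA (c : ℝ) : ℝ := 1 / (2 * (1 - c))

/-- The slope `b = 1 / (2 c)`. -/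
def slopeB (c : ℝ) : ℝ := 1 / (2 * c)

/-- `f_0(x) = a x` for `0 ≤ x ≤ 1 - c` and `1 - b (1 - x)` for `1 - c ≤ x ≤ 1`. -/
def f0 (c x : ℝ) : ℝ := if x ≤ 1 - c then slopeA c * x else 1 - slopeB c * (1 - x)

/-- `f_1(x) = b x` for `0 ≤ x ≤ c` and `1 - a (1 - x)` for `c ≤ x ≤ 1`. -/
def f1 (c x : ℝ) : ℝ := if x ≤ c then slopeB c * x else 1 - slopeA c * (1 - x)

theorem twoPiece_strictMono {s t p : ℝ} (hs : 0 < s) (ht : 0 < t)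
    (h : s * p = 1 - t * (1 - p)) :
    StrictMono fun x : ℝ => if x ≤ p then s * x else 1 - t * (1 - x) := by
  intro x y hxy
  dsimp only
  split_ifs with h1 h2 h2 <;> nlinarith

theorem twoPiece_continuous {s t p : ℝ} (h : s * p = 1 - t * (1 - p)) :
    Continuous fun x : ℝ => if x ≤ p then s * x else 1 - t * (1 - x) :=
  Continuous.if_le (by fun_prop) (by fun_prop) continuous_id continuous_const
    (by rintro x rfl; exact h)

theorem slopes_pos {c : ℝ} (hc : c ∈ Set.Ioo (0 : ℝ) (1 / 2)) : 0 < slopeA c ∧ 0 < slopeB c := by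
  obtain ⟨h0, h1⟩ := hc
  have h2 : 0 < 1 - c := by linarith
  unfold slopeA slopeB
  constructor <;> positivity

theorem slopes_mul {c : ℝ} (hc : c ∈ Set.Ioo (0 : ℝ) (1 / 2)) :
    slopeA c * (1 - c) = 1 / 2 ∧ slopeB c * c = 1 / 2 := by
  obtain ⟨h0, h1⟩ := hc
  have h2 : 1 - c ≠ 0 := by linarith
  have h3 : c ≠ 0 := by linarith
  unfold slopeA slopeB
  constructor <;> field_simp

theorem f0_facts {c : ℝ} (hc : c ∈ Set.Ioo (0 : ℝ) (1 / 2)) :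
    StrictMono (f0 c) ∧ Continuous (f0 c) ∧ f0 c 0 = 0 ∧ f0 c 1 = 1 := by
  obtain ⟨ha, hb⟩ := slopes_pos hc
  obtain ⟨h1, h2⟩ := slopes_mul hc
  obtain ⟨hc0, hc1⟩ := hc
  refine ⟨twoPiece_strictMono ha hb (by linarith), twoPiece_continuous (by linarith), ?_, ?_⟩
  · rw [f0, if_pos (by linarith), mul_zero]
  · rw [f0, if_neg (by linarith)]; ring

theorem f1_facts {c : ℝ} (hc : c ∈ Set.Ioo (0 : ℝ) (1 / 2)) :
    StrictMono (f1 c) ∧ Continuous (f1 c) ∧ f1 c 0 = 0 ∧ f1 c 1 = 1 := by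
  obtain ⟨ha, hb⟩ := slopes_pos hc
  obtain ⟨h1, h2⟩ := slopes_mul hc
  obtain ⟨hc0, hc1⟩ := hc
  refine ⟨twoPiece_strictMono hb ha (by linarith), twoPiece_continuous (by linarith), ?_, ?_⟩
  · rw [f1, if_pos (by linarith), mul_zero]
  · rw [f1, if_neg (by linarith)]; ring

/-- A continuous strictly increasing function fixing `0` and `1`, restricted to `[0,1]`,
as an order isomorphism (that is, an orientation preserving homeomorphism) of `[0,1]`. -/
def restrictIso (f : ℝ → ℝ) (hf : StrictMono f ∧ Continuous f ∧ f 0 = 0 ∧ f 1 = 1) : I ≃o I :=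
  StrictMono.orderIsoOfSurjective
    (fun x : I => (⟨f x, hf.2.2.1 ▸ hf.1.monotone x.2.1, hf.2.2.2 ▸ hf.1.monotone x.2.2⟩ : I))
    (fun _ _ h => hf.1 h)
    (by
      rintro ⟨y, hy⟩
      obtain ⟨x, hx, hxy⟩ := intermediate_value_Icc zero_le_one hf.2.1.continuousOn
        (show y ∈ Set.Icc (f 0) (f 1) by rwa [hf.2.2.1, hf.2.2.2])
      exact ⟨⟨x, hx⟩, Subtype.ext hxy⟩)

theorem restrictIso_coe (f : ℝ → ℝ) (hf : StrictMono f ∧ Continuous f ∧ f 0 = 0 ∧ f 1 = 1)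
    (x : I) : (restrictIso f hf x : ℝ) = f x := rfl

/-- The fiber map `f_j` on `[0,1]` for the symbol `j ∈ {0,1}`. -/
def fiberMap (c : ℝ) (hc : c ∈ Set.Ioo (0 : ℝ) (1 / 2)) (j : Fin 2) : I ≃o I :=
  if j = 0 then restrictIso (f0 c) (f0_facts hc) else restrictIso (f1 c) (f1_facts hc)

/-- The skew product `F(ω, x) = (σ ω, f_{ω_0}(x))` over the two-sided shift. -/
def skewF (c : ℝ) (hc : c ∈ Set.Ioo (0 : ℝ) (1 / 2)) : Equiv.Perm (TwoSided × I) where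
  toFun z := (shift z.1, fiberMap c hc (z.1 0) z.2)
  invFun z := (shift.symm z.1, (fiberMap c hc (shift.symm z.1 0)).symm z.2)
  left_inv z := by simp
  right_inv z := by simp

/-- The function `φ` of the family: the boundary of the basin of level `0` for `G = F⁻¹`,
a skew product over `R = σ⁻¹`. -/
def phi (c : ℝ) (hc : c ∈ Set.Ioo (0 : ℝ) (1 / 2)) : TwoSided → I :=
  basinBoundary shift⁻¹ (skewF c hc)⁻¹

theorem skewF_pow_fst (c : ℝ) (hc : c ∈ Set.Ioo (0 : ℝ) (1 / 2)) (n : ℕ) (z : TwoSided × I) :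
    ((skewF c hc ^ n) z).1 = (shift ^ n) z.1 := by
  induction n generalizing z with
  | zero => rfl
  | succ k ih => rw [pow_succ, pow_succ, Equiv.Perm.mul_apply, Equiv.Perm.mul_apply, ih]; rfl

theorem skewF_pow_snd_mono (c : ℝ) (hc : c ∈ Set.Ioo (0 : ℝ) (1 / 2)) (n : ℕ) (ω : TwoSided)
    {x y : I} (h : x ≤ y) : ((skewF c hc ^ n) (ω, x)).2 ≤ ((skewF c hc ^ n) (ω, y)).2 := by
  induction n generalizing ω x y with
  | zero => exact h
  | succ k ih =>
    rw [pow_succ, Equiv.Perm.mul_apply, Equiv.Perm.mul_apply]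
    exact ih _ ((fiberMap c hc (ω 0)).monotone h)

/-- The defining equation of `φ_{n,m}` for `G = F⁻¹`. -/
theorem phiNM_spec (c : ℝ) (hc : c ∈ Set.Ioo (0 : ℝ) (1 / 2)) (n m : ℕ) (ω : TwoSided) :
    ((skewF c hc)⁻¹ ^ n) (ω, phiNM shift⁻¹ (skewF c hc)⁻¹ n m ω) =
      ((shift⁻¹ ^ n) ω, invSucc m) := by
  have h1 : ((((skewF c hc)⁻¹ ^ n)⁻¹) ((shift⁻¹ ^ n) ω, invSucc m)).1 = ω := by
    rw [inv_pow, inv_inv, skewF_pow_fst, inv_pow]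
    simp
  have h2 : (ω, phiNM shift⁻¹ (skewF c hc)⁻¹ n m ω) =
      (((skewF c hc)⁻¹ ^ n)⁻¹) ((shift⁻¹ ^ n) ω, invSucc m) := Prod.ext h1.symm rfl
  rw [h2]
  simp

/-- The outer limit in the definition of `φ`. -/
theorem phi_tendsto (c : ℝ) (hc : c ∈ Set.Ioo (0 : ℝ) (1 / 2)) (ω : TwoSided) :
    Tendsto (fun m : ℕ => ⨆ N : ℕ, ⨅ n : ℕ, ⨅ _ : N ≤ n,
      phiNM shift⁻¹ (skewF c hc)⁻¹ n m ω) atTop (𝓝 (phi c hc ω)) := by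
  refine tendsto_atTop_iInf fun m m' h => iSup_mono fun N => iInf₂_mono fun n _ => ?_
  unfold phiNM
  rw [inv_pow (skewF c hc), inv_inv]
  refine skewF_pow_snd_mono c hc n _ ?_
  change (1 : ℝ) / ((m' : ℝ) + 1) ≤ 1 / ((m : ℝ) + 1)
  have : (m : ℝ) ≤ m' := by exact_mod_cast h
  gcongr

end RandomInterval

end

open RandomInterval

/-!
The iterates `F^{-n}(ω, x)` depend on `ω` only through its past `(ω_{-1}, ω_{-2}, …)`, whose law is
again Bernoulli, and their second coordinates `Y_n` form a random walk in `[0,1]` that applies one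
of the two inverse fiber maps with probability `1/2` each. These two maps average to the identity
(`symm_average`), so `Y_n` has constant mean `x`. They increase the second moment: the mean of
`Y_n (1 - Y_n)` drops at each step by `(1 - 2c)²` times the mean of `min(Y_n, 1 - Y_n)²`
(`symm_average_energy`). As `Y_n (1 - Y_n) ≥ 0`, the means of `min(Y_n, 1 - Y_n)²` are summable, so
`Y_n` almost surely approaches `{0, 1}`. A step at most doubles the distance to the nearer end point,
hence `Y_n` converges to `0` or to `1`, and since the mean is `x` the limit is `1` with probability
exactly `x` (`measure_tendsto_one`).

If the orbit of `x` tends to `0` then `x ≤ φ`, and if it tends to `1` then `φ ≤ x`; both follow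
directly from the formula for `φ`. Hence `φ < x` has probability at most `x` and `φ ≤ x` at least
`x`, so `φ` is uniformly distributed (`map_pastBoundary`) and almost surely lies in `(0,1)`. Applying
the dichotomy to a countable dense set of starting points shows that `φ` separates the basins, and
any other separating function agrees with `φ` almost everywhere by the same two implications.
Finally, `φ` is a function of the past, which is independent of the future `P ω`, so the joint law of
`P ω` and `φ ω` is the product `μ_+ × λ` (`map_graphMeasure_phi`).
-/

noncomputable section

namespace RandomInterval

/-! ### Independence of disjoint blocks of coordinates -/

instance : IsProbabilityMeasure coin := by unfold coin; infer_instance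

instance : IsProbabilityMeasure muOne := by unfold muOne; infer_instance

/-- Restricting to the two summands of the index type splits an i.i.d. family into independent ones:
the inverse map, which joins two families, turns boxes into products of boxes. -/
theorem map_restrict_sum_infinitePi {ι κ X : Type*} [MeasurableSpace X] (ν : Measure X)
    [IsProbabilityMeasure ν] :
    (Measure.infinitePi fun _ : ι ⊕ κ => ν).map
        (fun w => ((fun i => w (Sum.inl i) : ι → X), (fun j => w (Sum.inr j) : κ → X))) =
      (Measure.infinitePi fun _ : ι => ν).prod (Measure.infinitePi fun _ : κ => ν) := by
  classical
  have hm : Measurable (fun p : (ι → X) × (κ → X) => (Sum.elim p.1 p.2 : ι ⊕ κ → X)) := by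
    refine measurable_pi_lambda _ fun k => ?_
    cases k <;> simp only [Sum.elim_inl, Sum.elim_inr] <;> fun_prop
  have hjoin : ((Measure.infinitePi fun _ : ι => ν).prod (Measure.infinitePi fun _ : κ => ν)).map
      (fun p : (ι → X) × (κ → X) => (Sum.elim p.1 p.2 : ι ⊕ κ → X)) =
      Measure.infinitePi fun _ : ι ⊕ κ => ν := by
    refine Measure.eq_infinitePi _ fun s t ht => ?_
    rw [Measure.map_apply hm (.pi s.countable_toSet fun _ _ => ht _)]
    have hpre : (fun p : (ι → X) × (κ → X) => (Sum.elim p.1 p.2 : ι ⊕ κ → X)) ⁻¹'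
        (Set.pi (s : Set (ι ⊕ κ)) t) =
        (Set.pi (s.toLeft : Set ι) fun i => t (Sum.inl i)) ×ˢ
          (Set.pi (s.toRight : Set κ) fun j => t (Sum.inr j)) := by
      ext p
      simp [Set.mem_pi]
    rw [hpre, Measure.prod_prod, Measure.infinitePi_pi _ fun _ _ => ht _,
      Measure.infinitePi_pi _ fun _ _ => ht _,
      Finset.prod_sum_eq_prod_toLeft_mul_prod_toRight]
  rw [← hjoin, Measure.map_map (by fun_prop) hm]
  exact Measure.map_id

theorem map_restrict_infinitePi_equiv {ι κ γ X : Type*} [MeasurableSpace X] (ν : Measure X)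
    [IsProbabilityMeasure ν] (e : ι ⊕ κ ≃ γ) :
    (Measure.infinitePi fun _ : γ => ν).map
        (fun w => ((fun i => w (e (Sum.inl i)) : ι → X), (fun j => w (e (Sum.inr j)) : κ → X))) =
      (Measure.infinitePi fun _ : ι => ν).prod (Measure.infinitePi fun _ : κ => ν) := by
  rw [← map_restrict_sum_infinitePi ν,
    ← Measure.map_infinitePi_infinitePi_of_inj (P := fun _ : γ => ν) e.injective,
    Measure.map_map (by fun_prop) (by fun_prop)]
  rfl

/-- The past `(ω_{-1}, ω_{-2}, …)` of a two-sided sequence, read backwards in time. -/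
def past (ω : TwoSided) : OneSided := fun k => ω (Int.negSucc k)

/-- The one-sided left shift. -/
def tail (η : OneSided) : OneSided := fun k => η (k + 1)

@[fun_prop]
theorem measurable_proj : Measurable proj :=
  measurable_pi_lambda _ fun _ => measurable_pi_apply _

@[fun_prop]
theorem measurable_past : Measurable past :=
  measurable_pi_lambda _ fun _ => measurable_pi_apply _

@[fun_prop]
theorem measurable_tail : Measurable tail :=
  measurable_pi_lambda _ fun _ => measurable_pi_apply _

theorem map_proj_past : muTwo.map (fun ω => (proj ω, past ω)) = muOne.prod muOne :=
  map_restrict_infinitePi_equiv coin Equiv.intEquivNatSumNat.symm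

theorem map_past : muTwo.map past = muOne := by
  have h := congrArg (Measure.map Prod.snd) map_proj_past
  rw [Measure.map_map measurable_snd (by fun_prop), Measure.map_snd_prod] at h
  simpa [Function.comp_def] using h

theorem map_tail_head : muOne.map (fun η => (tail η, η 0)) = muOne.prod coin := by
  have h := map_restrict_infinitePi_equiv coin Equiv.natSumPUnitEquivNat.{0}
  have h2 := congrArg (Measure.map (Prod.map id fun u : PUnit → Fin 2 => u PUnit.unit)) h
  rw [← Measure.map_prod_map _ _ measurable_id (by fun_prop), Measure.map_id,
    Measure.infinitePi_map_eval, Measure.map_map (by fun_prop) (by fun_prop)] at h2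
  exact h2

theorem integral_coin (g : Fin 2 → ℝ) : ∫ j, g j ∂coin = (g 0 + g 1) / 2 := by
  rw [coin, PMF.integral_eq_sum]
  simp [Fin.sum_univ_two]
  ring

/-- Conditioning on the first symbol of a Bernoulli sequence. -/
theorem integral_tail_head (G : Fin 2 → OneSided → ℝ) (hG : ∀ j, Measurable (G j))
    {C : ℝ} (hC : ∀ j η, |G j η| ≤ C) :
    ∫ η, G (η 0) (tail η) ∂muOne = ((∫ η, G 0 η ∂muOne) + ∫ η, G 1 η ∂muOne) / 2 := by
  have hm : Measurable fun p : OneSided × Fin 2 => G p.2 p.1 :=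
    measurable_from_prod_countable_left hG
  have hint : ∀ j, Integrable (G j) muOne := fun j =>
    Integrable.of_bound (hG j).aestronglyMeasurable C (.of_forall fun η => hC j η)
  have h := integral_map (μ := muOne) (φ := fun η => (tail η, η 0)) (by fun_prop)
    (f := fun p => G p.2 p.1) hm.aestronglyMeasurable
  rw [← h, map_tail_head, integral_prod_symm]
  · exact integral_coin _
  · exact Integrable.of_bound hm.aestronglyMeasurable C (.of_forall fun p => hC _ _)

/-! ### The inverse fiber maps -/

variable {c : ℝ} {hc : c ∈ Set.Ioo (0 : ℝ) (1 / 2)}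

theorem fiberMap_zero_symm_coe (y : I) :
    (((fiberMap c hc 0).symm y : I) : ℝ) =
      if (y : ℝ) ≤ 1 / 2 then 2 * (1 - c) * y else 1 - 2 * c * (1 - y) := by
  obtain ⟨h0, h1⟩ := hc
  obtain ⟨z, rfl⟩ := (fiberMap c ⟨h0, h1⟩ 0).surjective y
  have hz : ((fiberMap c ⟨h0, h1⟩ 0 z : I) : ℝ) = f0 c z := rfl
  obtain ⟨ha, hb⟩ := slopes_pos ⟨h0, h1⟩
  obtain ⟨h2, h3⟩ := slopes_mul ⟨h0, h1⟩
  have e1 : 2 * (1 - c) * slopeA c = 1 := by linarith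
  have e2 : 2 * c * slopeB c = 1 := by linarith
  rw [OrderIso.symm_apply_apply, hz, f0]
  split_ifs with h4 h5 h5
  · linear_combination (-(z : ℝ)) * e1
  · exact absurd (show slopeA c * z ≤ 1 / 2 by nlinarith) h5
  · exact absurd (show ¬ 1 - slopeB c * (1 - z) ≤ 1 / 2 by nlinarith) (not_not.mpr h5)
  · linear_combination (1 - (z : ℝ)) * e2

theorem fiberMap_one_symm_coe (y : I) :
    (((fiberMap c hc 1).symm y : I) : ℝ) =
      if (y : ℝ) ≤ 1 / 2 then 2 * c * y else 1 - 2 * (1 - c) * (1 - y) := by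
  obtain ⟨h0, h1⟩ := hc
  obtain ⟨z, rfl⟩ := (fiberMap c ⟨h0, h1⟩ 1).surjective y
  have hz : ((fiberMap c ⟨h0, h1⟩ 1 z : I) : ℝ) = f1 c z := rfl
  obtain ⟨ha, hb⟩ := slopes_pos ⟨h0, h1⟩
  obtain ⟨h2, h3⟩ := slopes_mul ⟨h0, h1⟩
  have e1 : 2 * (1 - c) * slopeA c = 1 := by linarith
  have e2 : 2 * c * slopeB c = 1 := by linarith
  rw [OrderIso.symm_apply_apply, hz, f1]
  split_ifs with h4 h5 h5
  · linear_combination (-(z : ℝ)) * e2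
  · exact absurd (show slopeB c * z ≤ 1 / 2 by nlinarith) h5
  · exact absurd (show ¬ 1 - slopeA c * (1 - z) ≤ 1 / 2 by nlinarith) (not_not.mpr h5)
  · linear_combination (1 - (z : ℝ)) * e1

/-- The distance from `y` to the end points of `[0,1]`. -/
def endDist (y : I) : ℝ := min (y : ℝ) (1 - y)

theorem endDist_nonneg (y : I) : 0 ≤ endDist y := le_min y.2.1 (sub_nonneg.2 y.2.2)

@[fun_prop]
theorem measurable_endDist : Measurable endDist := by
  unfold endDist; fun_prop

/-- The two inverse fiber maps average to the identity. -/
theorem symm_average (y : I) :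
    ((((fiberMap c hc 0).symm y : I) : ℝ) + (((fiberMap c hc 1).symm y : I) : ℝ)) / 2 = y := by
  rw [fiberMap_zero_symm_coe, fiberMap_one_symm_coe]
  split_ifs <;> ring

/-- Averaging over the two inverse fiber maps decreases `y (1 - y)` by the variance of the step,
which has size `(1 - 2 * c) * endDist y` in either direction. -/
theorem symm_average_energy (y : I) :
    ((((fiberMap c hc 0).symm y : I) : ℝ) * (1 - (((fiberMap c hc 0).symm y : I) : ℝ)) +
      (((fiberMap c hc 1).symm y : I) : ℝ) * (1 - (((fiberMap c hc 1).symm y : I) : ℝ))) / 2 =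
      (y : ℝ) * (1 - y) - (1 - 2 * c) ^ 2 * endDist y ^ 2 := by
  rw [fiberMap_zero_symm_coe, fiberMap_one_symm_coe, endDist]
  split_ifs with h
  · rw [min_eq_left (by linarith)]; ring
  · rw [min_eq_right (by linarith)]; ring

theorem symm_le_two_mul (j : Fin 2) {y : I} (hy : (y : ℝ) ≤ 1 / 2) :
    (((fiberMap c hc j).symm y : I) : ℝ) ≤ 2 * y := by
  have h0 := hc.1
  have h1 := hc.2
  have h2 := y.2.1
  fin_cases j
  · refine (fiberMap_zero_symm_coe (hc := hc) y).trans_le ?_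
    rw [if_pos hy]; nlinarith
  · refine (fiberMap_one_symm_coe (hc := hc) y).trans_le ?_
    rw [if_pos hy]; nlinarith

theorem one_sub_symm_le_two_mul (j : Fin 2) {y : I} (hy : 1 / 2 < (y : ℝ)) :
    1 - (((fiberMap c hc j).symm y : I) : ℝ) ≤ 2 * (1 - y) := by
  have h0 := hc.1
  have h1 := hc.2
  have h2 := y.2.2
  fin_cases j
  · refine (congrArg (1 - ·) (fiberMap_zero_symm_coe (hc := hc) y)).trans_le ?_
    simp only [if_neg hy.not_ge]; nlinarith
  · refine (congrArg (1 - ·) (fiberMap_one_symm_coe (hc := hc) y)).trans_le ?_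
    simp only [if_neg hy.not_ge]; nlinarith

/-! ### Backward orbits -/

variable (c hc) in
/-- The composition of the inverse fiber maps along `η`: the symbol `η 0` acts first. -/
def backward : ℕ → OneSided → I ≃o I
  | 0, _ => OrderIso.refl I
  | n + 1, η => (fiberMap c hc (η 0)).symm.trans (backward n (tail η))

theorem backward_succ (n : ℕ) (η : OneSided) (x : I) :
    backward c hc (n + 1) η x = backward c hc n (tail η) ((fiberMap c hc (η 0)).symm x) := rfl

theorem backward_succ_symm (n : ℕ) (η : OneSided) (x : I) :
    (backward c hc (n + 1) η).symm x = fiberMap c hc (η 0) ((backward c hc n (tail η)).symm x) :=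
  rfl

theorem backward_succ' (n : ℕ) (η : OneSided) (x : I) :
    backward c hc (n + 1) η x = (fiberMap c hc (η n)).symm (backward c hc n η x) := by
  induction n generalizing η x with
  | zero => rfl
  | succ n ih => rw [backward_succ, ih, backward_succ n]; rfl

theorem skewF_inv_pow (n : ℕ) (ω : TwoSided) (x : I) :
    (((skewF c hc)⁻¹ ^ n) (ω, x)).2 = backward c hc n (past ω) x := by
  induction n generalizing ω x with
  | zero => rfl
  | succ n ih =>
    rw [pow_succ, Equiv.Perm.mul_apply]
    have h : (skewF c hc)⁻¹ (ω, x) =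
      (shift.symm ω, (fiberMap c hc (shift.symm ω 0)).symm x) := rfl
    rw [h, ih, backward_succ]
    rfl

theorem measurable_backward (n : ℕ) (x : I) : Measurable fun η => backward c hc n η x := by
  induction n generalizing x with
  | zero => exact measurable_const
  | succ n ih =>
    have h : Measurable fun p : OneSided × Fin 2 =>
        backward c hc n p.1 ((fiberMap c hc p.2).symm x) :=
      measurable_from_prod_countable_left fun j => ih ((fiberMap c hc j).symm x)
    exact h.comp (measurable_tail.prodMk (measurable_pi_apply 0))

theorem measurable_backward_symm (n : ℕ) (x : I) :
    Measurable fun η => (backward c hc n η).symm x := by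
  induction n with
  | zero => exact measurable_const
  | succ n ih =>
    have h : Measurable fun p : OneSided × Fin 2 =>
        fiberMap c hc p.2 ((backward c hc n p.1).symm x) :=
      measurable_from_prod_countable_left fun j =>
        (fiberMap c hc j).continuous.measurable.comp ih
    exact h.comp (measurable_tail.prodMk (measurable_pi_apply 0))

/-- A backward orbit that approaches the set `{0, 1}` converges to one of its points: an inverse
fiber map at most doubles the distance to the nearer end point, so that it cannot jump from one
end of the interval to the other. -/
theorem tendsto_zero_or_one_of_endDist {η : OneSided} {x : I}
    (h : Tendsto (fun n => endDist (backward c hc n η x)) atTop (𝓝 0)) :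
    Tendsto (fun n => backward c hc n η x) atTop (𝓝 0) ∨
      Tendsto (fun n => backward c hc n η x) atTop (𝓝 1) := by
  -- Once within `1 / 4` of an end point, doubling keeps the orbit in the same half of `[0,1]`.
  obtain ⟨N, hN⟩ := eventually_atTop.1 (h.eventually_lt_const (show (0 : ℝ) < 1 / 4 by norm_num))
  by_cases hcase : (backward c hc N η x : ℝ) ≤ 1 / 2
  · left
    have hle : ∀ n, N ≤ n → (backward c hc n η x : ℝ) ≤ 1 / 2 := by
      intro n hn
      induction n, hn using Nat.le_induction with
      | base => exact hcase
      | succ n hn ih =>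
        have h1 := hN n hn
        rw [endDist, min_eq_left (by linarith)] at h1
        have h2 := symm_le_two_mul (hc := hc) (η n) ih
        rw [backward_succ']
        linarith
    rw [tendsto_subtype_rng]
    refine h.congr' ?_
    filter_upwards [eventually_ge_atTop N] with n hn
    have := hle n hn
    rw [endDist, min_eq_left (by linarith)]
  · right
    have hle : ∀ n, N ≤ n → 1 / 2 < (backward c hc n η x : ℝ) := by
      intro n hn
      induction n, hn using Nat.le_induction with
      | base => exact not_le.1 hcase
      | succ n hn ih =>
        have h1 := hN n hn
        rw [endDist, min_eq_right (by linarith)] at h1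
        have h2 := one_sub_symm_le_two_mul (hc := hc) (η n) ih
        rw [backward_succ']
        linarith
    rw [tendsto_subtype_rng]
    have h1 : Tendsto (fun n => 1 - endDist (backward c hc n η x)) atTop (𝓝 (1 - 0)) :=
      h.const_sub 1
    rw [sub_zero] at h1
    refine h1.congr' ?_
    filter_upwards [eventually_ge_atTop N] with n hn
    have := hle n hn
    rw [endDist, min_eq_right (by linarith)]
    ring

/-! ### The random walk of backward iterates -/

/-- The Markov property of the backward iterates. -/
theorem integral_backward_succ {g : I → ℝ} (hg : Measurable g) {C : ℝ} (hC : ∀ y, |g y| ≤ C)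
    (n : ℕ) (x : I) :
    ∫ η, g (backward c hc (n + 1) η x) ∂muOne =
      ((∫ η, g (backward c hc n η ((fiberMap c hc 0).symm x)) ∂muOne) +
        ∫ η, g (backward c hc n η ((fiberMap c hc 1).symm x)) ∂muOne) / 2 :=
  integral_tail_head (fun j η => g (backward c hc n η ((fiberMap c hc j).symm x)))
    (fun _ => hg.comp (measurable_backward n _)) (fun _ _ => hC _)

theorem integral_backward (n : ℕ) (x : I) :
    ∫ η, (backward c hc n η x : ℝ) ∂muOne = x := by
  induction n generalizing x with
  | zero => simp [backward]
  | succ n ih =>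
    rw [integral_backward_succ (g := fun y : I => (y : ℝ)) measurable_subtype_coe (C := 1)
      (fun y => by rw [abs_of_nonneg y.2.1]; exact y.2.2), ih, ih, symm_average]

/-- The energy `y (1 - y)` of the backward iterates is dissipated at the rate of their squared
distance to the end points. -/
theorem integral_energy_succ (n : ℕ) (x : I) :
    ∫ η, (backward c hc (n + 1) η x : ℝ) * (1 - backward c hc (n + 1) η x) ∂muOne =
      (∫ η, (backward c hc n η x : ℝ) * (1 - backward c hc n η x) ∂muOne) -
        (1 - 2 * c) ^ 2 * ∫ η, endDist (backward c hc n η x) ^ 2 ∂muOne := by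
  have hg : Measurable fun y : I => (y : ℝ) * (1 - y) := by fun_prop
  have hgC : ∀ y : I, |(y : ℝ) * (1 - y)| ≤ 1 := fun y => by
    have h0 := y.2.1
    have h1 := y.2.2
    rw [abs_of_nonneg (by nlinarith)]; nlinarith
  have hd : Measurable fun y : I => endDist y ^ 2 := by fun_prop
  have hdC : ∀ y : I, |endDist y ^ 2| ≤ 1 := fun y => by
    have h0 := endDist_nonneg y
    have h1 : endDist y ≤ 1 := (min_le_left _ _).trans y.2.2
    rw [abs_of_nonneg (by positivity)]; nlinarith
  induction n generalizing x with
  | zero =>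
    rw [integral_backward_succ (g := fun y : I => (y : ℝ) * (1 - y)) hg hgC]
    simp only [backward, OrderIso.refl_apply, integral_const, probReal_univ, one_smul]
    exact symm_average_energy x
  | succ n ih =>
    rw [integral_backward_succ (g := fun y : I => (y : ℝ) * (1 - y)) hg hgC, ih, ih,
      integral_backward_succ (g := fun y : I => (y : ℝ) * (1 - y)) hg hgC,
      integral_backward_succ (g := fun y : I => endDist y ^ 2) hd hdC]
    ring

theorem sum_integral_endDist_sq_le (N : ℕ) (x : I) :
    ∑ n ∈ Finset.range N, ∫ η, endDist (backward c hc n η x) ^ 2 ∂muOne ≤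
      1 / (1 - 2 * c) ^ 2 := by
  have hpos : 0 < (1 - 2 * c) ^ 2 := by
    have := hc.2
    have : 0 < 1 - 2 * c := by linarith
    positivity
  have htel : (∫ η, (backward c hc N η x : ℝ) * (1 - backward c hc N η x) ∂muOne) +
      (1 - 2 * c) ^ 2 * ∑ n ∈ Finset.range N, ∫ η, endDist (backward c hc n η x) ^ 2 ∂muOne =
      (x : ℝ) * (1 - x) := by
    induction N with
    | zero => simp [backward]
    | succ N ih => rw [integral_energy_succ, Finset.sum_range_succ, ← ih]; ring
  have hnn : 0 ≤ ∫ η, (backward c hc N η x : ℝ) * (1 - backward c hc N η x) ∂muOne :=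
    integral_nonneg fun η => mul_nonneg (backward c hc N η x).2.1
      (sub_nonneg.2 (backward c hc N η x).2.2)
  rw [le_div_iff₀ hpos]
  nlinarith [x.2.1, x.2.2]

theorem ae_tendsto_endDist (x : I) :
    ∀ᵐ η ∂muOne, Tendsto (fun n => endDist (backward c hc n η x)) atTop (𝓝 0) := by
  have hm : ∀ n, Measurable fun η => endDist (backward c hc n η x) := fun n =>
    measurable_endDist.comp (measurable_backward n x)
  have hint : ∀ n, Integrable (fun η => endDist (backward c hc n η x) ^ 2) muOne := fun n =>
    Integrable.of_bound ((hm n).pow_const 2).aestronglyMeasurable 1 (.of_forall fun η => by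
      have h0 := endDist_nonneg (backward c hc n η x)
      have h1 : endDist (backward c hc n η x) ≤ 1 := 
        (min_le_left _ _).trans (backward c hc n η x).2.2
      rw [Real.norm_of_nonneg (by positivity)]; nlinarith)
  have hfin : ∫⁻ η, ∑' n, ENNReal.ofReal (endDist (backward c hc n η x) ^ 2) ∂muOne ≠ ⊤ := by
    rw [lintegral_tsum fun n => ((hm n).pow_const 2).ennreal_ofReal.aemeasurable]
    have hle : ∑' n, ∫⁻ η, ENNReal.ofReal (endDist (backward c hc n η x) ^ 2) ∂muOne ≤
        ENNReal.ofReal (1 / (1 - 2 * c) ^ 2) := by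
      refine ENNReal.tsum_le_of_sum_range_le fun N => ?_
      simp_rw [← ofReal_integral_eq_lintegral_ofReal (hint _) (.of_forall fun η => sq_nonneg _)]
      rw [← ENNReal.ofReal_sum_of_nonneg fun n _ => integral_nonneg fun η => sq_nonneg _]
      exact ENNReal.ofReal_le_ofReal (sum_integral_endDist_sq_le N x)
    exact ne_top_of_le_ne_top ENNReal.ofReal_ne_top hle
  filter_upwards [ae_lt_top' (AEMeasurable.tsum fun n =>
    ((hm n).pow_const 2).ennreal_ofReal.aemeasurable) hfin] with η hη
  have h1 := ENNReal.tendsto_atTop_zero_of_tsum_ne_top hη.ne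
  have h2 := (ENNReal.tendsto_toReal ENNReal.zero_ne_top).comp h1
  have h3 : Tendsto (fun n => endDist (backward c hc n η x) ^ 2) atTop (𝓝 0) := by
    refine h2.congr fun n => ?_
    simp [ENNReal.toReal_ofReal (sq_nonneg (endDist (backward c hc n η x)))]
  have h4 := h3.sqrt
  rw [Real.sqrt_zero] at h4
  exact h4.congr fun n => Real.sqrt_sq (endDist_nonneg _)

theorem ae_tendsto_zero_or_one (x : I) :
    ∀ᵐ η ∂muOne, Tendsto (fun n => backward c hc n η x) atTop (𝓝 0) ∨
      Tendsto (fun n => backward c hc n η x) atTop (𝓝 1) :=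
  (ae_tendsto_endDist x).mono fun _ => tendsto_zero_or_one_of_endDist

/-- The backward orbit of `x` tends to `1` with probability `x`, since its mean is constant. -/
theorem measure_tendsto_one (x : I) :
    muOne {η | Tendsto (fun n => backward c hc n η x) atTop (𝓝 1)} = ENNReal.ofReal x := by
  set A := {η | Tendsto (fun n => backward c hc n η x) atTop (𝓝 1)} with hA
  have hmA : MeasurableSet A := measurableSet_tendsto _ fun n => measurable_backward n x
  have hlim : Tendsto (fun n => ∫ η, (backward c hc n η x : ℝ) ∂muOne) atTop
      (𝓝 (∫ η, A.indicator (fun _ => (1 : ℝ)) η ∂muOne)) := by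
    refine tendsto_integral_of_dominated_convergence (fun _ => (1 : ℝ))
      (fun n => (measurable_subtype_coe.comp (measurable_backward n x)).aestronglyMeasurable)
      (integrable_const _) (fun n => .of_forall fun η => ?_) ?_
    · rw [Real.norm_of_nonneg (backward c hc n η x).2.1]
      exact (backward c hc n η x).2.2
    · filter_upwards [ae_tendsto_zero_or_one x] with η hη
      by_cases h : η ∈ A
      · rw [Set.indicator_of_mem h]
        exact tendsto_subtype_rng.1 h
      · rw [Set.indicator_of_notMem h]
        exact tendsto_subtype_rng.1 (hη.resolve_right h)
  simp_rw [integral_backward] at hlim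
  have h := tendsto_nhds_unique hlim tendsto_const_nhds
  rw [integral_indicator_const _ hmA, smul_eq_mul, mul_one] at h
  rw [← h, ofReal_measureReal]

/-! ### The boundary between the basins -/

variable (c hc) in
/-- The function `phi` as a function of the past alone, read backwards in time. -/
def pastBoundary (η : OneSided) : I :=
  ⨅ m : ℕ, ⨆ N : ℕ, ⨅ n : ℕ, ⨅ _ : N ≤ n, (backward c hc n η).symm (invSucc m)

theorem measurable_pastBoundary : Measurable (pastBoundary c hc) :=
  .iInf fun m => .iSup fun _ => .iInf fun n => .iInf fun _ => measurable_backward_symm n (invSucc m)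

theorem phi_eq_pastBoundary (ω : TwoSided) : phi c hc ω = pastBoundary c hc (past ω) := by
  have h : ∀ n m, phiNM shift⁻¹ (skewF c hc)⁻¹ n m ω =
      (backward c hc n (past ω)).symm (invSucc m) := fun n m => by
    rw [OrderIso.eq_symm_apply, ← skewF_inv_pow, phiNM_spec]
  simp only [phi, basinBoundary, pastBoundary, h]

theorem le_pastBoundary {η : OneSided} {x : I}
    (h : Tendsto (fun n => backward c hc n η x) atTop (𝓝 0)) : x ≤ pastBoundary c hc η := by
  refine le_iInf fun m => ?_
  have hm : (0 : I) < invSucc m := by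
    change (0 : ℝ) < 1 / ((m : ℝ) + 1)
    positivity
  obtain ⟨N, hN⟩ := eventually_atTop.1 (h.eventually_lt_const hm)
  exact le_iSup_of_le N (le_iInf₂ fun n hn => (OrderIso.le_symm_apply _).2 (hN n hn).le)

theorem pastBoundary_le {η : OneSided} {x : I}
    (h : Tendsto (fun n => backward c hc n η x) atTop (𝓝 1)) : pastBoundary c hc η ≤ x := by
  -- The level `invSucc 0 = 1` is not below the limit, so the level `1 / 2` is used.
  refine iInf_le_of_le 1 (iSup_le fun N => ?_)
  have hm : invSucc 1 < (1 : I) := by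
    change 1 / (((1 : ℕ) : ℝ) + 1) < 1
    norm_num
  obtain ⟨n, hn, hNn⟩ := ((h.eventually_const_lt hm).and (eventually_ge_atTop N)).exists
  exact iInf₂_le_of_le n hNn ((OrderIso.symm_apply_le _).2 hn.le)

/-- The boundary is uniformly distributed: up to null sets, the event that the backward orbit of
`x` tends to `1`, of probability `x`, lies between `pastBoundary < x` and `pastBoundary ≤ x`. -/
theorem map_pastBoundary : muOne.map (pastBoundary c hc) = (volume : Measure I) := by
  have hlt : ∀ x : I, muOne {η | pastBoundary c hc η < x} ≤ ENNReal.ofReal x := fun x => by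
    rw [← measure_tendsto_one (hc := hc) x]
    refine measure_mono_ae ?_
    filter_upwards [ae_tendsto_zero_or_one (hc := hc) x] with η hη hlt
    exact hη.resolve_left fun h0 => (le_pastBoundary h0).not_gt hlt
  have hle : ∀ x : I, ENNReal.ofReal x ≤ muOne {η | pastBoundary c hc η ≤ x} := fun x => by
    rw [← measure_tendsto_one (hc := hc) x]
    exact measure_mono fun η => pastBoundary_le
  have : IsProbabilityMeasure (muOne.map (pastBoundary c hc)) :=
    Measure.isProbabilityMeasure_map measurable_pastBoundary.aemeasurable
  refine Measure.ext_of_Iic _ _ fun x => ?_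
  rw [volume_Iic]
  refine le_antisymm ?_ ?_
  · rcases eq_or_lt_of_le (show x ≤ 1 from le_top) with rfl | hx
    · simpa using prob_le_one
    · have : (𝓝[>] x).NeBot := nhdsGT_neBot_of_exists_gt ⟨1, hx⟩
      have hcont : Tendsto (fun y : I => ENNReal.ofReal (y : ℝ)) (𝓝[>] x)
          (𝓝 (ENNReal.ofReal x)) :=
        ((ENNReal.continuous_ofReal.comp continuous_subtype_val).tendsto x).mono_left
          nhdsWithin_le_nhds
      refine ge_of_tendsto hcont ?_
      filter_upwards [self_mem_nhdsWithin] with y hy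
      rw [Measure.map_apply measurable_pastBoundary measurableSet_Iic]
      exact (measure_mono fun η (hη : pastBoundary c hc η ≤ x) =>
        show pastBoundary c hc η < y from lt_of_le_of_lt hη hy).trans (hlt y)
  · rw [Measure.map_apply measurable_pastBoundary measurableSet_Iic]
    exact hle x

theorem ae_pastBoundary_mem_Ioo :
    ∀ᵐ η ∂muOne, 0 < pastBoundary c hc η ∧ pastBoundary c hc η < 1 := by
  refine ae_of_ae_map (p := fun y : I => 0 < y ∧ y < 1)
    (measurable_pastBoundary (hc := hc)).aemeasurable ?_
  rw [map_pastBoundary]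
  have h0 : ∀ᵐ y : I, y ≠ 0 := by
    have : (volume : Measure I) (Set.Iic 0) = 0 := by rw [volume_Iic]; simp
    exact (measure_eq_zero_iff_ae_notMem.1 this).mono fun y hy h => hy h.le
  have h1 : ∀ᵐ y : I, y ≠ 1 := by
    have : (volume : Measure I) (Set.Ici 1) = 0 := by rw [volume_Ici]; simp
    exact (measure_eq_zero_iff_ae_notMem.1 this).mono fun y hy h => hy h.ge
  filter_upwards [h0, h1] with y hy0 hy1
  exact ⟨unitInterval.pos_iff_ne_zero.2 hy0, unitInterval.lt_one_iff_ne_one.2 hy1⟩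

/-- Almost surely the dichotomy of limits holds on a countable dense set of starting points; by
monotonicity in the starting point it extends to all points off the boundary. -/
theorem ae_pastBoundary_separates :
    ∀ᵐ η ∂muOne,
      (∀ x < pastBoundary c hc η, Tendsto (fun n => backward c hc n η x) atTop (𝓝 0)) ∧
      ∀ x > pastBoundary c hc η, Tendsto (fun n => backward c hc n η x) atTop (𝓝 1) := by
  obtain ⟨D, hDc, hDd⟩ := TopologicalSpace.exists_countable_dense I
  filter_upwards [(ae_ball_iff hDc).2 fun d _ => ae_tendsto_zero_or_one (hc := hc) d] with η hη
  refine ⟨fun x hx => ?_, fun x hx => ?_⟩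
  · obtain ⟨d, hd, hxd, hdb⟩ := hDd.exists_between hx
    have h := (hη d hd).resolve_right fun h => (pastBoundary_le h).not_gt hdb
    exact tendsto_of_tendsto_of_tendsto_of_le_of_le tendsto_const_nhds h (fun n => bot_le)
      fun n => (backward c hc n η).monotone hxd.le
  · obtain ⟨d, hd, hbd, hdx⟩ := hDd.exists_between hx
    have h := (hη d hd).resolve_left fun h => (le_pastBoundary h).not_gt hbd
    exact tendsto_of_tendsto_of_tendsto_of_le_of_le h tendsto_const_nhds
      (fun n => (backward c hc n η).monotone hdx.le) fun n => le_top

theorem measurable_phi : Measurable (phi c hc) := by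
  rw [funext phi_eq_pastBoundary]
  exact measurable_pastBoundary.comp measurable_past

theorem separatesBasins_phi : SeparatesBasins muTwo (skewF c hc) (phi c hc) := by
  have h : ∀ᵐ η ∂muTwo.map past, (0 < pastBoundary c hc η ∧ pastBoundary c hc η < 1) ∧
      (∀ x < pastBoundary c hc η, Tendsto (fun n => backward c hc n η x) atTop (𝓝 0)) ∧
      ∀ x > pastBoundary c hc η, Tendsto (fun n => backward c hc n η x) atTop (𝓝 1) := by
    rw [map_past]
    exact ae_pastBoundary_mem_Ioo.and ae_pastBoundary_separates
  refine (ae_of_ae_map measurable_past.aemeasurable h).mono fun ω hω => ?_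
  simp only [phi_eq_pastBoundary, skewF_inv_pow]
  exact ⟨hω.1.1, hω.1.2, hω.2.1, hω.2.2⟩

/-- The boundary between the basins is unique up to null sets. -/
theorem SeparatesBasins.ae_eq_phi {ψ : TwoSided → I}
    (h : SeparatesBasins muTwo (skewF c hc) ψ) : ψ =ᵐ[muTwo] phi c hc := by
  refine h.mono fun ω hω => ?_
  obtain ⟨-, -, h0, h1⟩ := hω
  simp only [skewF_inv_pow] at h0 h1
  rw [phi_eq_pastBoundary]
  exact le_antisymm (le_of_forall_lt_imp_le_of_dense fun x hx => le_pastBoundary (h0 x hx))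
    (le_of_forall_gt_imp_ge_of_dense fun x hx => pastBoundary_le (h1 x hx))

/-- The future is independent of the boundary, which depends on the past only. -/
theorem map_graphMeasure_phi :
    Measure.map (Prod.map proj id) (graphMeasure muTwo (phi c hc)) =
      muOne.prod (volume : Measure I) := by
  have h := Measure.map_prod_map muOne muOne measurable_id (measurable_pastBoundary (hc := hc))
  rw [Measure.map_id, map_pastBoundary, ← map_proj_past,
    Measure.map_map (measurable_id.prodMap measurable_pastBoundary) (by fun_prop)] at h
  rw [h, graphMeasure, Measure.map_map (by fun_prop) (measurable_id'.prodMk measurable_phi)]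
  congr 1
  funext ω
  exact Prod.ext rfl (phi_eq_pastBoundary ω)

end RandomInterval

end

open RandomInterval
theorem proposition6p2 (c : ℝ) (hc : c ∈ Set.Ioo (0 : ℝ) (1 / 2)) :
    (Measurable (phi c hc) ∧ SeparatesBasins muTwo (skewF c hc) (phi c hc)) ∧
    Measure.map (Prod.map proj id) (graphMeasure muTwo (phi c hc)) =
      muOne.prod (volume : Measure I) ∧
    ∀ ψ : TwoSided → I, Measurable ψ → SeparatesBasins muTwo (skewF c hc) ψ →
      Measure.map (Prod.map proj id) (graphMeasure muTwo ψ) =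
        muOne.prod (volume : Measure I) := by
  refine ⟨⟨measurable_phi, separatesBasins_phi⟩, map_graphMeasure_phi, fun ψ _ hsep => ?_⟩
  have h : graphMeasure muTwo ψ = graphMeasure muTwo (phi c hc) :=
    Measure.map_congr (hsep.ae_eq_phi.mono fun ω hω => by simp only [hω])
  rw [h, map_graphMeasure_phi]
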